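/- Let $p_0,p_1,p_2\in\mathbb R[s]$ and, for $k=(k_1,k_2)\in\mathbb R^2$, put $p(s,k)=p_0(s)+k_1p_1(s)+k_2p_2(s)$. Assume that $p(\cdot,k)$ is monic for every $k\in\mathbb R^2$ (so its degree $n$ does not depend on $k$). Let $$\mathcal S=\{k\in\mathbb R^2 : \text{all complex roots of } p(\cdot,k) \text{ have negative real part}\},\qquad \mathcal C=\{k\in\mathbb R^2 : p(j\omega,k)=0 \text{ for some } \omega\in\mathbb R\},$$ where $j$ is the imaginary unit. Let $p_R(\cdot,k),p_I(\cdot,k)$ be the real polynomials with $p_R(\omega^2,k)=\operatorname{Re}p(j\omega,k)$ and $\omega\,p_I(\omega^2,k)=\operatorname{Im}p(j\omega,k)$ for real $\omega$. The Hermite matrix $H(k)$ is the Bézoutian $B_\omega(p_R(\omega^2,k),\,\omega p_I(\omega^2,k))$, where, for polynomials $a,b$ of degree at most $n$, $B_\omega(a,b)=(b_{il})_{1\le i,l\le n}$ is the symmetric $n\times n$ matrix defined by $$\frac{a(u)b(v)-a(v)b(u)}{v-u}=\sum_{i=1}^n\sum_{l=1}^n b_{il}\,u^{i-1}v^{l-1}.$$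 Let $(\mathcal S_i)_i$ be the connected components of $\mathbb R^2\setminus\mathcal C$. Then $\mathcal S$ is exactly the union of those components $\mathcal S_i$ that contain at least one point $k$ with $H(k)\succ0$ (positive definite). -/

import Mathlib

open Polynomial

noncomputable section

namespace TwoParam

/-- The parametrized polynomial `p(s, k) = p₀(s) + k₁ p₁(s) + k₂ p₂(s)`, with `k = (k₁, k₂) ∈ ℝ²`. -/
def paramPoly (p₀ p₁ p₂ : ℝ[X]) (k : ℝ × ℝ) : ℝ[X] :=
  p₀ + C k.1 * p₁ + C k.2 * p₂

/-- Continuous-time stability: all complex roots lie in the open left half-plane. -/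
def IsStable (p : ℝ[X]) : Prop :=
  ∀ s : ℂ, aeval s p = 0 → s.re < 0

/-- The stability region in the parameter plane. -/
def stabilityRegion (p₀ p₁ p₂ : ℝ[X]) : Set (ℝ × ℝ) :=
  {k | IsStable (paramPoly p₀ p₁ p₂ k)}

/-- The curve of parameters for which the polynomial has a root on the imaginary axis. -/
def boundaryCurve (p₀ p₁ p₂ : ℝ[X]) : Set (ℝ × ℝ) :=
  {k | ∃ ω : ℝ, aeval (Complex.I * (ω : ℂ)) (paramPoly p₀ p₁ p₂ k) = 0}

/-- The polynomial `a(u) b(v) - a(v) b(u)`, seen as a polynomial in `v` (the outer variable)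
with coefficients in `ℝ[u]` (the inner variable). -/
def bezoutNumerator (a b : ℝ[X]) : ℝ[X][X] :=
  C a * b.map C - a.map C * C b

/-- The quotient `(a(u) b(v) - a(v) b(u)) / (v - u)`; the division is exact, see
`sub_mul_bezoutQuotient`. -/
def bezoutQuotient (a b : ℝ[X]) : ℝ[X][X] :=
  bezoutNumerator a b /ₘ (X - C X)

theorem sub_mul_bezoutQuotient (a b : ℝ[X]) :
    (X - C X) * bezoutQuotient a b = bezoutNumerator a b := by
  refine mul_divByMonic_eq_iff_isRoot.2 ?_
  simp [bezoutNumerator, IsRoot, eval_map, eval₂_C_X, mul_comm]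

/-- The Bézoutian matrix of size `n`: its entry `(i, j)` (indices from `0`) is the coefficient of
`u ^ i * v ^ j` in `(a(u) b(v) - a(v) b(u)) / (v - u)`. -/
def bezoutian (n : ℕ) (a b : ℝ[X]) : Matrix (Fin n) (Fin n) ℝ :=
  Matrix.of fun i j => ((bezoutQuotient a b).coeff j).coeff i

/-- The polynomial `p_R`, with `p_R(ω²) = Re p(jω)` (see `re_aeval_imag`). -/
def rePoly (p : ℝ[X]) : ℝ[X] :=
  ∑ m ∈ Finset.range (p.natDegree + 1), monomial m ((-1) ^ m * p.coeff (2 * m))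

/-- The polynomial `p_I`, with `ω p_I(ω²) = Im p(jω)` (see `im_aeval_imag`). -/
def imPoly (p : ℝ[X]) : ℝ[X] :=
  ∑ m ∈ Finset.range (p.natDegree + 1), monomial m ((-1) ^ m * p.coeff (2 * m + 1))

theorem aeval_imag (p : ℝ[X]) (ω : ℝ) :
    aeval (Complex.I * (ω : ℂ)) p =
      (((rePoly p).eval (ω ^ 2) : ℝ) : ℂ) + ((ω * (imPoly p).eval (ω ^ 2) : ℝ) : ℂ) * Complex.I := by
  have hsplit : ∀ (f : ℕ → ℂ) (N : ℕ), ∑ i ∈ Finset.range (2 * N), f i =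
      ∑ m ∈ Finset.range N, (f (2 * m) + f (2 * m + 1)) := by
    intro f N
    induction N with
    | zero => simp
    | succ N ih =>
      rw [Finset.sum_range_succ, ← ih, show 2 * (N + 1) = 2 * N + 1 + 1 by ring,
        Finset.sum_range_succ, Finset.sum_range_succ]
      ring
  rw [aeval_eq_sum_range' (n := 2 * (p.natDegree + 1)) (by omega), hsplit]
  simp only [rePoly, imPoly, eval_finsetSum, eval_monomial, Complex.ofReal_sum,
    Complex.ofReal_mul, Finset.mul_sum, Finset.sum_mul, ← Finset.sum_add_distrib]
  refine Finset.sum_congr rfl fun m _ => ?_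
  have hI : Complex.I ^ (2 * m) = (-1) ^ m := by rw [pow_mul, Complex.I_sq]
  simp only [Complex.real_smul, mul_pow, pow_succ, hI]
  push_cast
  ring

theorem re_aeval_imag (p : ℝ[X]) (ω : ℝ) :
    (aeval (Complex.I * (ω : ℂ)) p).re = (rePoly p).eval (ω ^ 2) := by
  rw [aeval_imag]; simp

theorem im_aeval_imag (p : ℝ[X]) (ω : ℝ) :
    (aeval (Complex.I * (ω : ℂ)) p).im = ω * (imPoly p).eval (ω ^ 2) := by
  rw [aeval_imag]; simp

/-- The Hermite matrix `H(p) = B_ω(p_R(ω²), ω p_I(ω²))`, of size the degree of `p`. -/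
def hermiteMatrix (p : ℝ[X]) : Matrix (Fin p.natDegree) (Fin p.natDegree) ℝ :=
  bezoutian p.natDegree ((rePoly p).comp (X ^ 2)) (X * (imPoly p).comp (X ^ 2))

/-- The connected components of a set `A` in the plane, with its subspace topology. -/
def components (A : Set (ℝ × ℝ)) : Set (Set (ℝ × ℝ)) :=
  {U | ∃ k ∈ A, U = connectedComponentIn A k}

end TwoParam

end

namespace TwoParam

/-! ### Sesquilinear forms attached to bivariate polynomials -/

/-! The proof combines Hermite's criterion at a single parameter with a clopen argument in the
parameter plane. Criterion (`posDef_hermiteMatrix_iff`): put `f(z) = p(iz) = a(z) + i b(z)` with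
`a`, `b` real, so that stability means all roots of `f` lie in the upper half-plane. The Bézoutian
of `a, b` has kernel `K_f(u,v) = (f*(u) f(v) - f(u) f*(v)) / (2i(v - u))`, where `f*` has the
conjugate coefficients. If it is positive definite, evaluating it at `(conj z, z)` for a root `z`
forces `Im z > 0`. Conversely, splitting off a root, `f = (X - c) g`, adds to the form of `g` a
square with weight `Im c > 0`, and induction on the degree gives definiteness
(`kernelForm_nonneg_and_eq_zero`). Clopen argument (`subset_stabilityRegion_of_isPreconnected`): the
stability region is open, and off the boundary curve it coincides with the closed set where all
roots satisfy `Re s ≤ 0`. A connected set avoiding the curve and meeting the region therefore lies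
inside it. -/

/-- The conjugate `q ↦ conj (L (conj q))` of a linear functional on `ℂ[X]`. -/
noncomputable def conjFunctional (L : ℂ[X] →ₗ[ℂ] ℂ) : ℂ[X] →ₗ[ℂ] ℂ where
  toFun q := starRingEnd ℂ (L (q.map (starRingEnd ℂ)))
  map_add' p q := by simp
  map_smul' c p := by simp

theorem conjFunctional_apply (L : ℂ[X] →ₗ[ℂ] ℂ) (q : ℂ[X]) :
    conjFunctional L q = starRingEnd ℂ (L (q.map (starRingEnd ℂ))) := rfl

/-- The value at a kernel `K(u, v)` of the tensor product of `conjFunctional L` (acting on `u`)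
and `L` (acting on `v`). -/
noncomputable def kernelForm (L : ℂ[X] →ₗ[ℂ] ℂ) : ℂ[X][X] →ₗ[ℂ] ℂ :=
  lsum fun j => L (X ^ j) • conjFunctional L

theorem kernelForm_monomial (L : ℂ[X] →ₗ[ℂ] ℂ) (j : ℕ) (a : ℂ[X]) :
    kernelForm L (monomial j a) = L (X ^ j) * conjFunctional L a := by
  simp [kernelForm, lsum_apply, sum_monomial_index]

theorem kernelForm_C_mul_map_C (L : ℂ[X] →ₗ[ℂ] ℂ) (a b : ℂ[X]) :
    kernelForm L (C a * b.map C) = conjFunctional L a * L b := by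
  induction b using Polynomial.induction_on' with
  | add p q hp hq => simp only [Polynomial.map_add, mul_add, map_add, hp, hq]
  | monomial n c =>
    rw [map_monomial, C_mul_monomial, kernelForm_monomial, mul_comm a, ← smul_eq_C_mul, map_smul,
      ← C_mul_X_pow_eq_monomial, ← smul_eq_C_mul, map_smul]
    simp only [smul_eq_mul]
    ring

theorem conj_map_conj (f : ℂ[X]) : (f.map (starRingEnd ℂ)).map (starRingEnd ℂ) = f := by
  ext; simp

/-- A factor `g*(u) g(v)` of the kernel is absorbed into the functional; this makes the induction
over the roots possible. -/
theorem kernelForm_mul (L : ℂ[X] →ₗ[ℂ] ℂ) (g : ℂ[X]) (K : ℂ[X][X]) :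
    kernelForm L (C (g.map (starRingEnd ℂ)) * g.map C * K) =
      kernelForm (L ∘ₗ LinearMap.mulLeft ℂ g) K := by
  induction K using Polynomial.induction_on' with
  | add p q hp hq => simp only [mul_add, map_add, hp, hq]
  | monomial n a =>
    have h : C (g.map (starRingEnd ℂ)) * g.map C * monomial n a =
        C (g.map (starRingEnd ℂ) * a) * (g * X ^ n).map C := by
      rw [← C_mul_X_pow_eq_monomial]
      simp only [C_mul, Polynomial.map_mul, Polynomial.map_pow, map_X]
      ring
    rw [h, kernelForm_C_mul_map_C, kernelForm_monomial]
    simp only [conjFunctional_apply, LinearMap.comp_apply, LinearMap.mulLeft_apply,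
      Polynomial.map_mul, conj_map_conj]
    ring

theorem eval_map_conj (f : ℂ[X]) (z : ℂ) :
    (f.map (starRingEnd ℂ)).eval z = starRingEnd ℂ (f.eval (starRingEnd ℂ z)) := by
  rw [← eval_map_apply, Complex.conj_conj]

/-- Positivity of the Hermite form: if all roots of `f` lie in the open upper half-plane, then
the kernel `(f*(u) f(v) - f(u) f*(v)) / (2 i (v - u))` induces a form which is positive definite
on functionals restricted to polynomials of degree less than `deg f`. -/
theorem kernelForm_nonneg_and_eq_zero (n : ℕ) : ∀ (f : ℂ[X]), f ≠ 0 → f.natDegree = n →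
    (∀ z, f.IsRoot z → 0 < z.im) → ∀ K : ℂ[X][X],
    C (C (2 * Complex.I)) * (X - C X) * K =
      C (f.map (starRingEnd ℂ)) * f.map C - C f * (f.map (starRingEnd ℂ)).map C →
    ∀ L : ℂ[X] →ₗ[ℂ] ℂ, 0 ≤ (kernelForm L K).re ∧
      ((kernelForm L K).re = 0 → ∀ q : ℂ[X], q.degree < n → L q = 0) := by
  have hcancel : (C (C (2 * Complex.I)) * (X - C X) : ℂ[X][X]) ≠ 0 := by
    refine mul_ne_zero ?_ (X_sub_C_ne_zero _)
    simp
  induction n with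
  | zero =>
    intro f _ hdeg _ K hK L
    obtain ⟨α, rfl⟩ := natDegree_eq_zero.1 hdeg
    have hK0 : K = 0 := by
      refine (mul_eq_zero.1 (hK.trans ?_)).resolve_left hcancel
      simp [mul_comm]
    subst hK0
    refine ⟨by simp, fun _ q hq => ?_⟩
    rw [Nat.cast_zero, Nat.WithBot.lt_zero_iff, degree_eq_bot] at hq
    simp [hq]
  | succ n ih =>
    intro f hf hdeg hroot K hK L
    obtain ⟨c, hc⟩ := IsAlgClosed.exists_root f (by
      rw [degree_eq_natDegree hf, hdeg]; exact_mod_cast n.succ_ne_zero)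
    obtain ⟨g, rfl⟩ := dvd_iff_isRoot.2 hc
    have hg : g ≠ 0 := right_ne_zero_of_mul hf
    have hgdeg : g.natDegree = n := by
      rw [natDegree_mul (X_sub_C_ne_zero c) hg, natDegree_X_sub_C] at hdeg; omega
    have hgroot : ∀ z, g.IsRoot z → 0 < z.im := fun z hz =>
      hroot z (by simp [IsRoot.def.1 hz])
    have hcim := hroot c hc
    obtain ⟨M, hM⟩ : (X - C X : ℂ[X][X]) ∣
        C (g.map (starRingEnd ℂ)) * g.map C - C g * (g.map (starRingEnd ℂ)).map C := by
      rw [dvd_iff_isRoot]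
      simp [IsRoot, eval_map, eval₂_C_X, mul_comm]
    obtain ⟨G, hGM⟩ : ∃ G : ℂ[X][X], C (C (2 * Complex.I)) * (X - C X) * G =
        C (g.map (starRingEnd ℂ)) * g.map C - C g * (g.map (starRingEnd ℂ)).map C := by
      have hCI : (C (C (2 * Complex.I)) * C (C (2 * Complex.I)⁻¹) : ℂ[X][X]) = 1 := by
        rw [← C_mul, ← C_mul, mul_inv_cancel₀ (by simp), C_1, C_1]
      exact ⟨C (C (2 * Complex.I)⁻¹) * M, by rw [hM]; linear_combination (X - C X) * M * hCI⟩
    have hcc : (C (C c) - C (C (starRingEnd ℂ c)) : ℂ[X][X]) =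
        C (C (c.im : ℂ)) * C (C (2 * Complex.I)) := by
      rw [← C_mul, ← C_mul, ← C_sub, ← C_sub, Complex.sub_conj]
      push_cast
      ring_nf
    -- The recursion `K_f = (u - conj c)(v - c) K_g + Im c · g(u) g*(v)`; under `kernelForm L` the
    -- last term becomes `Im c · |L g*|²`.
    have hKeq : K = C ((X - C c).map (starRingEnd ℂ)) * (X - C c).map C * G +
        (c.im : ℂ) • (C g * (g.map (starRingEnd ℂ)).map C) := by
      refine mul_left_cancel₀ hcancel (hK.trans ?_)
      have hs : (c.im : ℂ) • (C g * (g.map (starRingEnd ℂ)).map C) =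
          C (C (c.im : ℂ)) * (C g * (g.map (starRingEnd ℂ)).map C) := by
        ext; simp [coeff_C_mul]
      rw [hs]
      generalize (C (C (2 * Complex.I)) : ℂ[X][X]) = t at hGM hcc ⊢
      simp only [Polynomial.map_mul, Polynomial.map_sub, map_X, map_C, C_mul, C_sub]
      linear_combination (-(C X - C (C (starRingEnd ℂ c))) * (X - C (C c))) * hGM +
        (X - C X) * (C g * (g.map (starRingEnd ℂ)).map C) * hcc
    have hval : (kernelForm L K).re = (kernelForm (L ∘ₗ LinearMap.mulLeft ℂ (X - C c)) G).re +
        c.im * Complex.normSq (L (g.map (starRingEnd ℂ))) := by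
      rw [hKeq, map_add, map_smul, kernelForm_mul, kernelForm_C_mul_map_C, conjFunctional_apply,
        mul_comm (starRingEnd ℂ _), Complex.mul_conj, smul_eq_mul, ← Complex.ofReal_mul,
        Complex.add_re, Complex.ofReal_re]
    obtain ⟨h0, h1⟩ := ih g hg hgdeg hgroot G hGM (L ∘ₗ LinearMap.mulLeft ℂ (X - C c))
    have hnn : 0 ≤ c.im * Complex.normSq (L (g.map (starRingEnd ℂ))) :=
      mul_nonneg hcim.le (Complex.normSq_nonneg _)
    refine ⟨by rw [hval]; exact add_nonneg h0 hnn, fun hz => ?_⟩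
    rw [hval] at hz
    have hker := h1 (by linarith)
    have hLg : L (g.map (starRingEnd ℂ)) = 0 := by
      have : c.im * Complex.normSq (L (g.map (starRingEnd ℂ))) = 0 := by linarith
      exact Complex.normSq_eq_zero.1 ((mul_eq_zero.1 this).resolve_left hcim.ne')
    -- `L` kills the multiples of `X - c` in this degree range, so it only sees `q(c)`.
    have hred : ∀ q : ℂ[X], q.degree < (n + 1 : ℕ) → L q = q.eval c * L 1 := by
      intro q hq
      have hdiv : (X - C c) * (q /ₘ (X - C c)) + C (q.eval c) = q := by
        conv_rhs => rw [← modByMonic_add_div q (X - C c), modByMonic_X_sub_C_eq_C_eval]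
        ring
      have hlt : (q /ₘ (X - C c)).degree < n := by
        by_cases hq0 : q /ₘ (X - C c) = 0
        · rw [hq0, degree_zero]; exact WithBot.bot_lt_coe n
        · rw [degree_eq_natDegree hq0, natDegree_divByMonic q (monic_X_sub_C c),
            natDegree_X_sub_C]
          have hqn : q ≠ 0 := by rintro rfl; simp at hq0
          rw [degree_eq_natDegree hqn] at hq
          have h2 : q.natDegree < n + 1 := by exact_mod_cast hq
          have h3 : 1 ≤ q.natDegree := by
            by_contra h
            obtain ⟨α, rfl⟩ := natDegree_eq_zero.1 (by omega : q.natDegree = 0)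
            apply hq0
            rw [divByMonic_eq_zero_iff (monic_X_sub_C c), degree_X_sub_C]
            exact degree_C_lt
          exact_mod_cast (by omega : q.natDegree - 1 < n)
      have := hker _ hlt
      rw [LinearMap.comp_apply, LinearMap.mulLeft_apply] at this
      conv_lhs => rw [← hdiv]
      rw [map_add, this, zero_add, ← mul_one (C _), ← smul_eq_C_mul, map_smul, smul_eq_mul]
    have hL1 : L 1 = 0 := by
      have h2 := hred (g.map (starRingEnd ℂ)) (by
        rw [degree_map, degree_eq_natDegree hg, hgdeg]; exact_mod_cast n.lt_succ_self)
      rw [hLg, eval_map_conj] at h2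
      -- `g*(c) = conj (g (conj c))` is nonzero: `conj c` lies in the lower half-plane, where `g`
      -- has no root.
      refine (mul_eq_zero.1 h2.symm).resolve_left fun h3 => ?_
      have h4 := hgroot _ ((map_eq_zero _).1 h3)
      rw [Complex.conj_im] at h4
      linarith
    intro q hq
    rw [hred q hq, hL1, mul_zero]

/-! ### The Bézoutian -/

theorem coeff_coeff_swap {R : Type*} [CommRing R] (K : R[X][X]) (i j : ℕ) :
    ((Bivariate.swap K).coeff i).coeff j = (K.coeff j).coeff i := by
  induction K using Polynomial.induction_on' with
  | add p q hp hq => simp only [map_add, coeff_add, hp, hq]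
  | monomial n a =>
    induction a using Polynomial.induction_on' with
    | add p q hp hq => simp only [map_add, coeff_add, hp, hq]
    | monomial m r =>
      rw [Bivariate.swap_monomial_monomial]
      simp only [coeff_monomial]
      split_ifs <;> simp_all [coeff_monomial]

/-- Exchanging `u` and `v` changes the sign of both the numerator and `v - u`. The symmetry also
carries the degree bound in `v` over to `u`. -/
theorem swap_bezoutQuotient (a b : ℝ[X]) :
    Bivariate.swap (bezoutQuotient a b) = bezoutQuotient a b := by
  refine mul_left_cancel₀ (X_sub_C_ne_zero (X : ℝ[X])) ?_
  have h := congrArg (Bivariate.swap (R := ℝ)) (sub_mul_bezoutQuotient a b)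
  rw [map_mul, map_sub, Bivariate.swap_X, Bivariate.swap_Y, bezoutNumerator, map_sub, map_mul,
    map_mul, Bivariate.swap_C, Bivariate.swap_map_C, Bivariate.swap_C, Bivariate.swap_map_C] at h
  rw [sub_mul_bezoutQuotient, bezoutNumerator]
  linear_combination -h

theorem coeff_bezoutQuotient_comm (a b : ℝ[X]) (i j : ℕ) :
    ((bezoutQuotient a b).coeff j).coeff i = ((bezoutQuotient a b).coeff i).coeff j := by
  conv_lhs => rw [← coeff_coeff_swap, swap_bezoutQuotient]

theorem natDegree_bezoutQuotient_lt {n : ℕ} (hn : 0 < n) {a b : ℝ[X]} (ha : a.natDegree ≤ n)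
    (hb : b.natDegree ≤ n) : (bezoutQuotient a b).natDegree < n := by
  have h : (bezoutNumerator a b).natDegree ≤ n := by
    refine (natDegree_sub_le _ _).trans (max_le ?_ ?_)
    · exact (natDegree_C_mul_le _ _).trans (natDegree_map_le.trans hb)
    · exact (natDegree_mul_C_le _ _).trans (natDegree_map_le.trans ha)
  rw [bezoutQuotient, natDegree_divByMonic _ (monic_X_sub_C _), natDegree_X_sub_C]
  omega

theorem natDegree_coeff_bezoutQuotient_lt {n : ℕ} (hn : 0 < n) {a b : ℝ[X]}
    (ha : a.natDegree ≤ n) (hb : b.natDegree ≤ n) (j : ℕ) :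
    ((bezoutQuotient a b).coeff j).natDegree < n := by
  refine Nat.lt_of_le_pred hn (natDegree_le_iff_coeff_eq_zero.2 fun i hi => ?_)
  replace hi : n ≤ i := Nat.le_of_pred_lt hi
  rw [coeff_bezoutQuotient_comm,
    coeff_eq_zero_of_natDegree_lt ((natDegree_bezoutQuotient_lt hn ha hb).trans_le hi), coeff_zero]

theorem isHermitian_bezoutian (n : ℕ) (a b : ℝ[X]) : (bezoutian n a b).IsHermitian := by
  ext i j
  simp [bezoutian, coeff_bezoutQuotient_comm a b i j]

theorem aevalAeval_map_C (w z : ℂ) (b : ℝ[X]) : aevalAeval w z (b.map C) = aeval z b := by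
  rw [← Bivariate.swap_C, Bivariate.aevalAeval_swap]
  simp

theorem sub_mul_aevalAeval_bezoutQuotient (a b : ℝ[X]) (w z : ℂ) :
    (z - w) * aevalAeval w z (bezoutQuotient a b) =
      aeval w a * aeval z b - aeval z a * aeval w b := by
  have h := congrArg (aevalAeval w z) (sub_mul_bezoutQuotient a b)
  rw [bezoutNumerator, map_mul, map_sub, map_sub, map_mul, map_mul, aevalAeval_map_C,
    aevalAeval_map_C] at h
  simpa using h

theorem aevalAeval_bezoutQuotient {n : ℕ} (hn : 0 < n) {a b : ℝ[X]} (ha : a.natDegree ≤ n)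
    (hb : b.natDegree ≤ n) (w z : ℂ) :
    aevalAeval w z (bezoutQuotient a b) =
      ∑ j : Fin n, ∑ i : Fin n, (bezoutian n a b i j : ℂ) * w ^ (i : ℕ) * z ^ (j : ℕ) := by
  have hdeg := natDegree_bezoutQuotient_lt hn ha hb
  conv_lhs => rw [as_sum_range' _ n hdeg]
  rw [map_sum, ← Fin.sum_univ_eq_sum_range
    (fun j => aevalAeval w z (monomial j ((bezoutQuotient a b).coeff j)))]
  refine Finset.sum_congr rfl fun j _ => ?_
  have h : aevalAeval w z (monomial (j : ℕ) ((bezoutQuotient a b).coeff j)) =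
      aeval w ((bezoutQuotient a b).coeff j) * z ^ (j : ℕ) := by
    rw [← C_mul_X_pow_eq_monomial, map_mul, map_pow]
    simp
  rw [h, aeval_eq_sum_range' (natDegree_coeff_bezoutQuotient_lt hn ha hb j),
    ← Fin.sum_univ_eq_sum_range
      (fun i => ((bezoutQuotient a b).coeff j).coeff i • w ^ i), Finset.sum_mul]
  simp [bezoutian]

theorem sum_mul_mul_eq_dotProduct_mulVec {n : ℕ} (M : Matrix (Fin n) (Fin n) ℝ)
    (y : Fin n → ℝ) : ∑ j, ∑ i, M i j * y i * y j = star y ⬝ᵥ (M.mulVec y) := by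
  simp only [dotProduct, Matrix.mulVec, Finset.mul_sum]
  rw [Finset.sum_comm]
  refine Finset.sum_congr rfl fun i _ => Finset.sum_congr rfl fun j _ => ?_
  simp only [Pi.star_apply, star_trivial]
  ring

/-- A real positive definite matrix is positive definite as a Hermitian form. -/
theorem re_sum_pos_of_posDef {n : ℕ} {M : Matrix (Fin n) (Fin n) ℝ} (hM : M.PosDef)
    {x : Fin n → ℂ} (hx : x ≠ 0) :
    0 < (∑ j, ∑ i, (M i j : ℂ) * starRingEnd ℂ (x i) * x j).re := by
  have hsplit : (∑ j, ∑ i, (M i j : ℂ) * starRingEnd ℂ (x i) * x j).re =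
      star (fun i => (x i).re) ⬝ᵥ (M.mulVec fun i => (x i).re) +
        star (fun i => (x i).im) ⬝ᵥ (M.mulVec fun i => (x i).im) := by
    rw [← sum_mul_mul_eq_dotProduct_mulVec, ← sum_mul_mul_eq_dotProduct_mulVec,
      ← Finset.sum_add_distrib, Complex.re_sum]
    refine Finset.sum_congr rfl fun j _ => ?_
    rw [← Finset.sum_add_distrib, Complex.re_sum]
    refine Finset.sum_congr rfl fun i _ => ?_
    simp
  rw [hsplit]
  by_cases hre : (fun i => (x i).re) = 0
  · have him : (fun i => (x i).im) ≠ 0 := fun him =>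
      hx (funext fun i => Complex.ext (congrFun hre i) (congrFun him i))
    exact add_pos_of_nonneg_of_pos (hM.posSemidef.dotProduct_mulVec_nonneg _)
      (hM.dotProduct_mulVec_pos him)
  · exact add_pos_of_pos_of_nonneg (hM.dotProduct_mulVec_pos hre)
      (hM.posSemidef.dotProduct_mulVec_nonneg _)

/-! ### Hermite's criterion -/

/-- If the Bézoutian of `a, b` is positive definite, the roots of `a + i b` lie in the open upper
half-plane. -/
theorem im_pos_of_posDef_bezoutian {n : ℕ} (hn : 0 < n) {a b : ℝ[X]} (ha : a.natDegree ≤ n)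
    (hb : b.natDegree ≤ n) (hM : (bezoutian n a b).PosDef) {z : ℂ}
    (hz : aeval z a + Complex.I * aeval z b = 0) : 0 < z.im := by
  have hx : (fun i : Fin n => z ^ (i : ℕ)) ≠ 0 := fun h => by
    simpa using congrFun h ⟨0, hn⟩
  have hpos := re_sum_pos_of_posDef hM hx
  simp only [map_pow] at hpos
  rw [← aevalAeval_bezoutQuotient hn ha hb] at hpos
  have hA : aeval z a = -(Complex.I * aeval z b) := eq_neg_of_add_eq_zero_left hz
  have hconj : ∀ c : ℝ[X], aeval (starRingEnd ℂ z) c = starRingEnd ℂ (aeval z c) :=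
    fun c => aeval_conj c z
  have hmul := sub_mul_aevalAeval_bezoutQuotient a b (starRingEnd ℂ z) z
  rw [hconj, hconj, hA, Complex.sub_conj] at hmul
  -- At a root `a(z) = -i b(z)`, so the Bézout identity at `(conj z, z)` reads `Im z · B(conj z, z)
  -- = |b(z)|²`.
  have hre : z.im * (aevalAeval (starRingEnd ℂ z) z (bezoutQuotient a b)).re =
      Complex.normSq (aeval z b) := by
    have h := congrArg Complex.im hmul
    simp [Complex.normSq_apply] at h ⊢
    linarith
  rcases lt_trichotomy z.im 0 with h | h | h
  · have := mul_neg_of_neg_of_pos h hpos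
    linarith [Complex.normSq_nonneg (aeval z b)]
  · exfalso
    rw [h, zero_mul, eq_comm, Complex.normSq_eq_zero] at hre
    rw [hre, mul_zero, neg_zero] at hA
    -- A real root would be common to `a` and `b`, making `B(w, z)` vanish for `w ≠ z` and, by
    -- continuity, at `w = z` too, against positivity.
    have hB : ∀ w : ℂ, w ≠ z → aevalAeval w z (bezoutQuotient a b) = 0 := fun w hw => by
      have := sub_mul_aevalAeval_bezoutQuotient a b w z
      rw [hA, hre, mul_zero, zero_mul, sub_zero] at this
      exact (mul_eq_zero.1 this).resolve_left (sub_ne_zero.2 hw.symm)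
    have hcont : Continuous fun w : ℂ => aevalAeval w z (bezoutQuotient a b) := by
      simp only [aevalAeval_bezoutQuotient hn ha hb]
      fun_prop
    have hzero : (fun w : ℂ => aevalAeval w z (bezoutQuotient a b)) = fun _ => 0 :=
      hcont.ext_on (dense_compl_singleton z) continuous_const fun w hw => hB w hw
    rw [congrFun hzero] at hpos
    simp at hpos
  · exact h

/-- If `a + i b` has degree `n` and its roots lie in the open upper half-plane, then the Bézoutian
of `a, b` is positive definite. -/
theorem posDef_bezoutian_of_im_pos {n : ℕ} {a b : ℝ[X]} {f : ℂ[X]}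
    (hf : f = a.map Complex.ofRealHom + C Complex.I * b.map Complex.ofRealHom) (hf0 : f ≠ 0)
    (hdeg : f.natDegree = n) (hroot : ∀ z, f.IsRoot z → 0 < z.im) :
    (bezoutian n a b).PosDef := by
  have hreal : ∀ c : ℝ[X], (c.map Complex.ofRealHom).map (starRingEnd ℂ) =
      c.map Complex.ofRealHom := fun c => by ext; simp
  have hfc : f.map (starRingEnd ℂ) =
      a.map Complex.ofRealHom - C Complex.I * b.map Complex.ofRealHom := by
    rw [hf, Polynomial.map_add, Polynomial.map_mul, hreal, hreal, map_C, Complex.conj_I, C_neg]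
    ring
  set K : ℂ[X][X] := (bezoutQuotient a b).map (mapRingHom Complex.ofRealHom) with hKdef
  have hK : C (C (2 * Complex.I)) * (X - C X) * K =
      C (f.map (starRingEnd ℂ)) * f.map C - C f * (f.map (starRingEnd ℂ)).map C := by
    have h := congrArg (Polynomial.map (mapRingHom Complex.ofRealHom)) (sub_mul_bezoutQuotient a b)
    simp only [bezoutNumerator, Polynomial.map_mul, Polynomial.map_sub, map_X, map_C,
      coe_mapRingHom, Polynomial.map_map, mapRingHom_comp_C] at h
    rw [mul_assoc, h, hfc, hf]
    simp only [Polynomial.map_mul, Polynomial.map_sub, Polynomial.map_add, map_C, C_mul, C_sub,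
      C_add, Polynomial.map_map, C_ofNat]
    ring
  refine Matrix.PosDef.of_dotProduct_mulVec_pos (isHermitian_bezoutian n a b) fun x hx => ?_
  -- Pairing with the vector `x`: `L` vanishes on `X ^ j` for `j ≥ n`, so only the `n × n` block of
  -- `K` contributes.
  let L : ℂ[X] →ₗ[ℂ] ℂ := ∑ j : Fin n, (x j : ℂ) • lcoeff ℂ j
  have hL : ∀ q, L q = ∑ j : Fin n, (x j : ℂ) * q.coeff j := fun q => by
    simp [L, LinearMap.sum_apply]
  have hLX : ∀ j, L (X ^ j) = if h : j < n then (x ⟨j, h⟩ : ℂ) else 0 := fun j => by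
    rw [hL]
    split_ifs with h
    · rw [Finset.sum_eq_single ⟨j, h⟩]
      · simp
      · intro i _ hi
        rw [coeff_X_pow, if_neg fun h' => hi (Fin.ext h'), mul_zero]
      · simp
    · refine Finset.sum_eq_zero fun i _ => ?_
      rw [coeff_X_pow, if_neg (by omega), mul_zero]
  have hval : kernelForm L K = ((star x ⬝ᵥ (bezoutian n a b).mulVec x : ℝ) : ℂ) := by
    have hconj : ∀ c : ℝ[X], conjFunctional L (c.map Complex.ofRealHom) =
        ((∑ i : Fin n, x i * c.coeff i : ℝ) : ℂ) := fun c => by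
      rw [conjFunctional_apply, hreal, hL]
      simp
    have hsum : kernelForm L K = ∑ j ∈ Finset.range (max n (K.natDegree + 1)),
        L (X ^ j) * conjFunctional L (K.coeff j) := by
      rw [kernelForm, lsum_apply, sum_over_range' _ (fun j => by simp) _
        (Nat.lt_of_succ_le (le_max_right _ _))]
      rfl
    rw [hsum, ← Finset.sum_subset (Finset.range_mono (le_max_left n (K.natDegree + 1)))
      fun j _ hj => by rw [hLX, dif_neg (by simpa using hj), zero_mul],
      ← Fin.sum_univ_eq_sum_range (fun j => L (X ^ j) * conjFunctional L (K.coeff j)),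
      ← sum_mul_mul_eq_dotProduct_mulVec, Complex.ofReal_sum]
    refine Finset.sum_congr rfl fun j _ => ?_
    rw [hLX, dif_pos j.2, hKdef, coeff_map, coe_mapRingHom, hconj, ← Complex.ofReal_mul,
      Finset.mul_sum]
    congr 1
    refine Finset.sum_congr rfl fun i _ => ?_
    simp only [bezoutian, Matrix.of_apply]
    ring
  obtain ⟨h0, h1⟩ := kernelForm_nonneg_and_eq_zero n f hf0 hdeg hroot K hK L
  rw [hval, Complex.ofReal_re] at h0 h1
  refine lt_of_le_of_ne h0 fun h => hx (funext fun j => ?_)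
  have := h1 h.symm (X ^ (j : ℕ)) (by rw [degree_X_pow]; exact_mod_cast j.2)
  rw [hLX, dif_pos j.2] at this
  exact_mod_cast this

theorem posDef_hermiteMatrix_iff {p : ℝ[X]} (hp : p.Monic) :
    (hermiteMatrix p).PosDef ↔ IsStable p := by
  set a := (rePoly p).comp (X ^ 2) with ha
  set b := X * (imPoly p).comp (X ^ 2) with hb
  have hf : (p.map Complex.ofRealHom).comp (C Complex.I * X) =
      a.map Complex.ofRealHom + C Complex.I * b.map Complex.ofRealHom := by
    refine eq_of_infinite_eval_eq _ _
      ((Set.infinite_range_of_injective Complex.ofReal_injective).mono ?_)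
    rintro _ ⟨ω, rfl⟩
    have h : ∀ (c : ℝ[X]) (x : ℂ), (c.map Complex.ofRealHom).eval x = aeval x c :=
      fun c x => eval_map_algebraMap c x
    have hr : ∀ c : ℝ[X], aeval (ω : ℂ) c = ((c.eval ω : ℝ) : ℂ) :=
      fun c => aeval_algebraMap_apply_eq_algebraMap_eval ω c
    rw [Set.mem_ofPred_eq, eval_comp, eval_add, eval_mul, eval_mul, eval_C, eval_X, h, h, h, hr,
      hr, aeval_imag, ha, hb]
    simp
    ring
  have hcoeff : ∀ m, ((p.map Complex.ofRealHom).comp (C Complex.I * X)).coeff m =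
      p.coeff m * Complex.I ^ m := fun m => by
    rw [comp_C_mul_X_coeff, coeff_map, Complex.ofRealHom_eq_coe]
  have hre : ∀ m, ((a.coeff m : ℝ) : ℂ) + Complex.I * (b.coeff m : ℝ) =
      p.coeff m * Complex.I ^ m := fun m => by
    rw [← hcoeff, hf]
    simp
  -- `rePoly` and `imPoly` are summed over a generous range; the degree bounds come from comparing
  -- real and imaginary parts of coefficients.
  have hzero : ∀ m, p.natDegree < m → a.coeff m = 0 ∧ b.coeff m = 0 := fun m hm => by
    have h := hre m
    rw [coeff_eq_zero_of_natDegree_lt hm] at h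
    exact ⟨by simpa using congrArg Complex.re h, by simpa using congrArg Complex.im h⟩
  have hroot : ∀ z : ℂ, ((p.map Complex.ofRealHom).comp (C Complex.I * X)).eval z =
      aeval (Complex.I * z) p := fun z => by
    rw [eval_comp, eval_mul, eval_C, eval_X]
    exact eval_map_algebraMap p _
  constructor
  · intro hM s hs
    have hn : 0 < p.natDegree := by
      by_contra h
      rw [hp.natDegree_eq_zero.1 (by omega), map_one] at hs
      exact one_ne_zero hs
    have hz := hroot (-Complex.I * s)
    rw [show Complex.I * (-Complex.I * s) = s by
      linear_combination (-s) * Complex.I_mul_I, hs, hf, eval_add, eval_mul, eval_C] at hz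
    have := im_pos_of_posDef_bezoutian hn
      (natDegree_le_iff_coeff_eq_zero.2 fun m hm => (hzero m hm).1)
      (natDegree_le_iff_coeff_eq_zero.2 fun m hm => (hzero m hm).2) hM
      (z := -Complex.I * s) (by
        rw [← eval_map_algebraMap, ← eval_map_algebraMap]; exact hz)
    simpa using this
  · intro hst
    have htop := hcoeff p.natDegree
    rw [hp.coeff_natDegree, Complex.ofReal_one, one_mul] at htop
    have hne : ((p.map Complex.ofRealHom).comp (C Complex.I * X)).coeff p.natDegree ≠ 0 := by
      rw [htop]; exact pow_ne_zero _ Complex.I_ne_zero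
    refine posDef_bezoutian_of_im_pos hf (fun h => hne (by rw [h, coeff_zero])) ?_ ?_
    · refine natDegree_eq_of_le_of_coeff_ne_zero (natDegree_le_iff_coeff_eq_zero.2 fun m hm => ?_)
        hne
      rw [hcoeff, coeff_eq_zero_of_natDegree_lt hm, Complex.ofReal_zero, zero_mul]
    · intro z hz
      rw [IsRoot, hroot] at hz
      simpa using hst _ hz

/-! ### Degree and continuity of the parametrized polynomial -/

/-- Otherwise a suitable `t` would give the perturbed polynomial a leading coefficient other than 1.
-/
theorem degree_lt_of_forall_monic {p q : ℝ[X]} (h : ∀ t : ℝ, (p + C t * q).Monic) :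
    q.degree < p.degree := by
  by_contra! hle
  have hp : p.Monic := by simpa using h 0
  have hq : q ≠ 0 := by
    rintro rfl
    exact hp.ne_zero (degree_eq_bot.1 (le_bot_iff.1 hle))
  have hlc : q.leadingCoeff ≠ 0 := leadingCoeff_ne_zero.2 hq
  have hnat : p.natDegree ≤ q.natDegree := natDegree_le_natDegree hle
  -- This `t` makes the coefficient at `q.natDegree` equal to 5, an arbitrary value different from 0
  -- and 1.
  have hm := h ((5 - p.coeff q.natDegree) / q.leadingCoeff)
  have hcoeff : (p + C ((5 - p.coeff q.natDegree) / q.leadingCoeff) * q).coeff q.natDegree = 5 := by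
    rw [coeff_add, coeff_C_mul, coeff_natDegree, div_mul_cancel₀ _ hlc]; ring
  have hdeg : (p + C ((5 - p.coeff q.natDegree) / q.leadingCoeff) * q).natDegree ≤ q.natDegree :=
    natDegree_add_le_of_degree_le hnat (natDegree_C_mul_le _ _)
  have heq := le_antisymm hdeg (le_natDegree_of_ne_zero (by rw [hcoeff]; norm_num))
  have := hm.coeff_natDegree
  rw [heq, hcoeff] at this
  norm_num at this

variable {p₀ p₁ p₂ : ℝ[X]}

theorem natDegree_paramPoly (hmonic : ∀ k, (paramPoly p₀ p₁ p₂ k).Monic) (k : ℝ × ℝ) :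
    (paramPoly p₀ p₁ p₂ k).natDegree = p₀.natDegree := by
  have h₁ : p₁.degree < p₀.degree :=
    degree_lt_of_forall_monic fun t => by simpa [paramPoly] using hmonic (t, 0)
  have h₂ : p₂.degree < p₀.degree :=
    degree_lt_of_forall_monic fun t => by simpa [paramPoly] using hmonic (0, t)
  have hC : ∀ (t : ℝ) {q : ℝ[X]}, q.degree < p₀.degree → (C t * q).degree < p₀.degree :=
    fun t q hq => (by rw [← smul_eq_C_mul]; exact (degree_smul_le t q).trans_lt hq)
  have h₃ : (p₀ + C k.1 * p₁).degree = p₀.degree := degree_add_eq_left_of_degree_lt (hC _ h₁)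
  refine natDegree_eq_natDegree ?_
  rw [paramPoly, degree_add_eq_left_of_degree_lt, h₃]
  rw [h₃]
  exact hC _ h₂

theorem aeval_paramPoly (k : ℝ × ℝ) (s : ℂ) :
    aeval s (paramPoly p₀ p₁ p₂ k) = aeval s p₀ + k.1 * aeval s p₁ + k.2 * aeval s p₂ := by
  simp [paramPoly]

theorem continuous_aeval_paramPoly :
    Continuous fun x : (ℝ × ℝ) × ℂ => aeval x.2 (paramPoly p₀ p₁ p₂ x.1) := by
  simp only [aeval_paramPoly]
  fun_prop

/-! ### Bounds on monic polynomials -/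

/-- Each factor satisfies `|s - c| ≥ Re s - Re c ≥ Re s`. The resulting inequality is a closed
condition on the coefficients. -/
theorem re_pow_natDegree_le_norm_aeval {p : ℝ[X]} (hp : p.Monic)
    (hroot : ∀ s : ℂ, aeval s p = 0 → s.re ≤ 0) {s : ℂ} (hs : 0 < s.re) :
    s.re ^ p.natDegree ≤ ‖aeval s p‖ := by
  have hsplit : (p.map (algebraMap ℝ ℂ)).Splits := IsAlgClosed.splits _
  have hcard : (p.aroots ℂ).card = p.natDegree := by
    rw [aroots_def, ← hsplit.natDegree_eq_card_roots, natDegree_map]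
  rw [hsplit.aeval_eq_prod_aroots_of_monic hp, ← hcard]
  have hmem : ∀ c ∈ p.aroots ℂ, c.re ≤ 0 := fun c hc => hroot c ((mem_aroots.1 hc).2)
  revert hmem
  generalize p.aroots ℂ = m
  induction m using Multiset.induction_on with
  | empty => simp
  | cons c m ih =>
    intro hmem
    rw [Multiset.card_cons, Multiset.map_cons, Multiset.prod_cons, norm_mul, pow_succ']
    refine mul_le_mul ?_ (ih fun c hc => hmem c (Multiset.mem_cons_of_mem hc))
      (pow_nonneg hs.le _) (norm_nonneg _)
    have h1 := hmem c (Multiset.mem_cons_self c m)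
    have h2 := Complex.re_le_norm (s - c)
    rw [Complex.sub_re] at h2
    linarith

/-- The bound is continuous in the coefficients, so roots at nearby parameters stay in one fixed
ball. -/
theorem norm_le_of_aeval_eq_zero {p : ℝ[X]} (hp : p.Monic) {s : ℂ} (hs : aeval s p = 0) :
    ‖s‖ ≤ 1 + ∑ i ∈ Finset.range p.natDegree, |p.coeff i| := by
  by_contra! hlt
  have hsum : 0 ≤ ∑ i ∈ Finset.range p.natDegree, |p.coeff i| :=
    Finset.sum_nonneg fun i _ => abs_nonneg _
  have h1 : 1 < ‖s‖ := by linarith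
  rcases Nat.eq_zero_or_pos p.natDegree with h0 | hpos
  · rw [hp.natDegree_eq_zero.1 h0, map_one] at hs
    exact one_ne_zero hs
  rw [aeval_eq_sum_range, Finset.sum_range_succ, hp.coeff_natDegree, one_smul] at hs
  have h2 : ‖s‖ ^ p.natDegree ≤
      (∑ i ∈ Finset.range p.natDegree, |p.coeff i|) * ‖s‖ ^ (p.natDegree - 1) := by
    rw [← norm_pow, eq_neg_of_add_eq_zero_right hs, norm_neg, Finset.sum_mul]
    refine (norm_sum_le _ _).trans (Finset.sum_le_sum fun i hi => ?_)
    rw [norm_smul, norm_pow, Real.norm_eq_abs]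
    have := Finset.mem_range.1 hi
    exact mul_le_mul_of_nonneg_left (pow_le_pow_right₀ h1.le (by omega)) (abs_nonneg _)
  rw [← Nat.sub_add_cancel hpos, pow_succ', Nat.sub_add_cancel hpos] at h2
  have := le_of_mul_le_mul_right h2 (pow_pos (by linarith) _)
  linarith

/-! ### The stability region is relatively clopen off the boundary curve -/

theorem isOpen_stabilityRegion (hmonic : ∀ k, (paramPoly p₀ p₁ p₂ k).Monic) :
    IsOpen (stabilityRegion p₀ p₁ p₂) := by
  rw [isOpen_iff_eventually]
  intro k hk
  let B : ℝ × ℝ → ℝ := fun k' =>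
    1 + ∑ i ∈ Finset.range p₀.natDegree, |(paramPoly p₀ p₁ p₂ k').coeff i|
  have hB : Continuous B := by
    simp only [B, paramPoly, coeff_add, coeff_C_mul]
    fun_prop
  -- The extra 1 in the radius leaves room for the root bound to vary near `k`; compactness makes
  -- nonvanishing on `D` persist near `k`.
  let D : Set ℂ := Metric.closedBall 0 (B k + 1) ∩ {s | 0 ≤ s.re}
  have hD : IsCompact D := (isCompact_closedBall 0 _).inter_right
    (isClosed_le continuous_const Complex.continuous_re)
  have hev : ∀ᶠ k' in nhds k, ∀ s ∈ D, aeval s (paramPoly p₀ p₁ p₂ k') ≠ 0 := by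
    refine hD.eventually_forall_of_forall_eventually fun s hs => ?_
    refine (continuous_aeval_paramPoly (p₀ := p₀) (p₁ := p₁) (p₂ := p₂)).continuousAt.eventually_ne
      fun h0 => ?_
    exact absurd (hk s h0) (not_lt.2 hs.2)
  have hbd : ∀ᶠ k' in nhds k, B k' < B k + 1 :=
    hB.continuousAt.eventually_lt continuousAt_const (by simp)
  filter_upwards [hev, hbd] with k' h1 h2 s hs
  by_contra! hre
  refine h1 s ⟨?_, hre⟩ hs
  rw [mem_closedBall_zero_iff]
  refine (norm_le_of_aeval_eq_zero (hmonic k') hs).trans ?_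
  rw [natDegree_paramPoly hmonic]
  exact h2.le

theorem isClosed_setOf_forall_root_re_nonpos (hmonic : ∀ k, (paramPoly p₀ p₁ p₂ k).Monic) :
    IsClosed {k | ∀ s : ℂ, aeval s (paramPoly p₀ p₁ p₂ k) = 0 → s.re ≤ 0} := by
  have heq : {k | ∀ s : ℂ, aeval s (paramPoly p₀ p₁ p₂ k) = 0 → s.re ≤ 0} =
      ⋂ (s : ℂ) (_ : 0 < s.re),
        {k | s.re ^ p₀.natDegree ≤ ‖aeval s (paramPoly p₀ p₁ p₂ k)‖} := by
    ext k
    simp only [Set.mem_ofPred_eq, Set.mem_iInter]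
    constructor
    · intro h s hs
      rw [← natDegree_paramPoly hmonic k]
      exact re_pow_natDegree_le_norm_aeval (hmonic k) h hs
    · intro h s hs
      by_contra! hre
      have h1 := h s hre
      rw [hs, norm_zero] at h1
      exact absurd h1 (not_le.2 (pow_pos hre _))
  rw [heq]
  refine isClosed_iInter fun s => isClosed_iInter fun _ => isClosed_le continuous_const ?_
  exact (continuous_aeval_paramPoly.comp (Continuous.prodMk_left s)).norm

theorem boundaryCurve_disjoint_stabilityRegion :
    Disjoint (boundaryCurve p₀ p₁ p₂) (stabilityRegion p₀ p₁ p₂) := by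
  rw [Set.disjoint_left]
  rintro k ⟨ω, hω⟩ hk
  have := hk _ hω
  simp at this

theorem subset_stabilityRegion_of_isPreconnected (hmonic : ∀ k, (paramPoly p₀ p₁ p₂ k).Monic)
    {U : Set (ℝ × ℝ)} (hU : IsPreconnected U) (hUC : U ⊆ (boundaryCurve p₀ p₁ p₂)ᶜ)
    (hne : (U ∩ stabilityRegion p₀ p₁ p₂).Nonempty) : U ⊆ stabilityRegion p₀ p₁ p₂ := by
  refine hU.subset_left_of_subset_union (isOpen_stabilityRegion hmonic)
    (isClosed_setOf_forall_root_re_nonpos hmonic).isOpen_compl ?_ ?_ hne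
  · rw [Set.disjoint_compl_right_iff_subset]
    exact fun k hk s hs => (hk s hs).le
  · intro k hkU
    by_contra! h
    rw [Set.mem_union, not_or, Set.mem_compl_iff, not_not] at h
    refine h.1 fun s hs => lt_of_le_of_ne (h.2 s hs) fun h0 => hUC hkU ⟨s.im, ?_⟩
    rwa [show Complex.I * (s.im : ℂ) = s from Complex.ext (by simp [h0]) (by simp)]

end TwoParam

theorem mainTheorem5 (p₀ p₁ p₂ : Polynomial ℝ)
    (hmonic : ∀ k : ℝ × ℝ, (TwoParam.paramPoly p₀ p₁ p₂ k).Monic) :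
    TwoParam.stabilityRegion p₀ p₁ p₂ =
      ⋃₀ {U | U ∈ TwoParam.components (TwoParam.boundaryCurve p₀ p₁ p₂)ᶜ ∧
        ∃ k ∈ U, (TwoParam.hermiteMatrix (TwoParam.paramPoly p₀ p₁ p₂ k)).PosDef} := by
  ext k
  constructor
  · intro hk
    have hkC : k ∈ (TwoParam.boundaryCurve p₀ p₁ p₂)ᶜ := fun h =>
      Set.disjoint_left.1 TwoParam.boundaryCurve_disjoint_stabilityRegion h hk
    exact ⟨connectedComponentIn (TwoParam.boundaryCurve p₀ p₁ p₂)ᶜ k,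
      ⟨⟨k, hkC, rfl⟩, k, mem_connectedComponentIn hkC,
        (TwoParam.posDef_hermiteMatrix_iff (hmonic k)).2 hk⟩, mem_connectedComponentIn hkC⟩
  · rintro ⟨_, ⟨⟨k₀, _, rfl⟩, k₁, hk₁, hpos⟩, hk⟩
    exact TwoParam.subset_stabilityRegion_of_isPreconnected hmonic
      isPreconnected_connectedComponentIn (connectedComponentIn_subset _ _)
      ⟨k₁, hk₁, (TwoParam.posDef_hermiteMatrix_iff (hmonic k₁)).1 hpos⟩ hk
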